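/- (a) Let $H$ be a finite-dimensional complex Hilbert space and let $T$ be a self-adjoint operator on $H\otimes H$ with $\|T\|\le 1$. For each tensor power $H^{\otimes m}$ put $T_i = 1^{\otimes(i-1)}\otimes T\otimes 1^{\otimes(m-i-1)}$ for $1\le i\le m-1$, and assume that $T$ is braided: $T_1T_2T_1=T_2T_1T_2$ on $H^{\otimes 3}$. Define $R_m = 1+T_1+T_1T_2+\dots+T_1T_2\cdots T_{m-1}$ on $H^{\otimes m}$, and define $P_m$ on $H^{\otimes m}$ by $P_2=R_2$ and $P_{m+1}=(1\otimes P_m)R_{m+1}$. (The Fock inner product on $H^{\otimes m}$ is $\langle X, P_mY\rangle$.) Then for every $n\ge 2$, $$\ker P_{n+1}=\sum_{k+l=n-1}H^{\otimes k}\otimes\ker(1+T)\otimes H^{\otimes l}=\sum_{k=1}^{n}\ker(1+T_k),$$ where $T_1,\dots,T_n$ act on $H^{\otimes(n+1)}$. (b) More generally, let $K$ be a complex Hilbert space, let $n\ge 0$, and let $T_1,\dots,T_n$ be bounded self-adjoint operators on $K$ with $\|T_i\|\le 1$ that satisfy the braid relations $T_iT_{i+1}T_i=T_{i+1}T_iT_{i+1}$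 for $1\le i\le n-1$ and $T_iT_j=T_jT_i$ for $|i-j|\ge 2$. Put $$P_{n+1}=(1+T_n)(1+T_{n-1}+T_{n-1}T_n)\cdots(1+T_1+T_1T_2+\dots+T_1T_2\cdots T_n),$$ with $P_1=1$ when $n=0$. Then $$\ker P_{n+1}=\overline{\sum_{k=1}^n\ker(1+T_k)},$$ and the closure can be omitted if $K$ is finite-dimensional. -/

import Mathlib

open scoped TensorProduct

noncomputable section

namespace Wick

section Algebra

variable {A : Type*} [Ring A]

/-- For a family `t = (t₁, …, tₙ)` of ring elements, the element
`1 + t₁ + t₁ t₂ + ⋯ + t₁ t₂ ⋯ tₙ`. -/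
def rElt {n : ℕ} (t : Fin n → A) : A :=
  ∑ j ∈ Finset.range (n + 1), ((List.ofFn t).take j).prod

/-- For a family `t = (t₁, …, tₙ)` of ring elements, the element `P_{n+1}(t₁, …, tₙ)`, given by
`P₁ = 1` and `P_{n+1}(t₁, …, tₙ) = P_n(t₂, …, tₙ) (1 + t₁ + t₁ t₂ + ⋯ + t₁ t₂ ⋯ tₙ)`. -/
def pElt : (n : ℕ) → (Fin n → A) → A
  | 0, _ => 1
  | n + 1, t => pElt n (Fin.tail t) * rElt t

/-- The braid relations (with the far commutation relations) for a finite family. -/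
structure IsBraidFamily {n : ℕ} (t : Fin n → A) : Prop where
  braid : ∀ i j : Fin n, (i : ℕ) + 1 = j → t i * t j * t i = t j * t i * t j
  comm : ∀ i j : Fin n, (i : ℕ) + 2 ≤ j → t i * t j = t j * t i

end Algebra

section Tensor

variable {H : Type*} [AddCommGroup H] [Module ℂ H]

/-- The canonical identification `H ≃ H^{⊗1}`. -/
def oneEquiv : H ≃ₗ[ℂ] (⨂[ℂ]^1 H) :=
  (PiTensorProduct.subsingletonEquiv (R := ℂ) (s := fun _ : Fin 1 => H) (0 : Fin 1)).symm

/-- The canonical identification `H ⊗ H ≃ H^{⊗2}`. -/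
def twoEquiv : H ⊗[ℂ] H ≃ₗ[ℂ] (⨂[ℂ]^2 H) :=
  (TensorProduct.congr oneEquiv oneEquiv).trans (TensorPower.mulEquiv (n := 1) (m := 1))

/-- The canonical identification `H ⊗ H^{⊗n} ≃ H^{⊗(n+1)}`. -/
def consEquiv (n : ℕ) : H ⊗[ℂ] (⨂[ℂ]^n H) ≃ₗ[ℂ] (⨂[ℂ]^(n + 1) H) :=
  ((TensorProduct.congr oneEquiv (LinearEquiv.refl ℂ _)).trans
    (TensorPower.mulEquiv (n := 1) (m := n))).trans (TensorPower.cast ℂ H (Nat.add_comm 1 n))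

/-- The canonical identification `H^{⊗k} ⊗ (H ⊗ H) ⊗ H^{⊗l} ≃ H^{⊗m}`, where `k + 2 + l = m`. -/
def placeEquiv (k l m : ℕ) (h : k + 2 + l = m) :
    ((⨂[ℂ]^k H) ⊗[ℂ] (H ⊗[ℂ] H)) ⊗[ℂ] (⨂[ℂ]^l H) ≃ₗ[ℂ] (⨂[ℂ]^m H) :=
  ((TensorProduct.congr
      ((TensorProduct.congr (LinearEquiv.refl ℂ _) twoEquiv).trans
        (TensorPower.mulEquiv (n := k) (m := 2)))
      (LinearEquiv.refl ℂ _)).trans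
    (TensorPower.mulEquiv (n := k + 2) (m := l))).trans (TensorPower.cast ℂ H h)

/-- The operator `1^{⊗k} ⊗ T ⊗ 1^{⊗l}` on `H^{⊗m}`, where `k + 2 + l = m`. -/
def leg (T : Module.End ℂ (H ⊗[ℂ] H)) (k l m : ℕ) (h : k + 2 + l = m) :
    Module.End ℂ (⨂[ℂ]^m H) :=
  (placeEquiv k l m h).conj
    (TensorProduct.map (TensorProduct.map LinearMap.id T) LinearMap.id)

/-- The subspace `H^{⊗k} ⊗ V ⊗ H^{⊗l}` of `H^{⊗m}`, for a subspace `V` of `H ⊗ H`, where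
`k + 2 + l = m`. -/
def placeSubmodule (V : Submodule ℂ (H ⊗[ℂ] H)) (k l m : ℕ) (h : k + 2 + l = m) :
    Submodule ℂ (⨂[ℂ]^m H) :=
  (LinearMap.range
    (TensorProduct.map
      (TensorProduct.map (LinearMap.id : (⨂[ℂ]^k H) →ₗ[ℂ] (⨂[ℂ]^k H)) V.subtype)
      (LinearMap.id : (⨂[ℂ]^l H) →ₗ[ℂ] (⨂[ℂ]^l H)))).map
    (placeEquiv k l m h).toLinearMap

/-- The family `T₁, …, Tₙ` on `H^{⊗(n+1)}`. The index is zero-based: the value at `i` is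
`1^{⊗i} ⊗ T ⊗ 1^{⊗(n-1-i)}`, that is, the operator `T_{i+1}`. -/
def legs (T : Module.End ℂ (H ⊗[ℂ] H)) (n : ℕ) : Fin n → Module.End ℂ (⨂[ℂ]^(n + 1) H) :=
  fun i => leg T i (n - 1 - i) (n + 1) (by have := i.isLt; omega)

/-- `T` is braided: `T₁ T₂ T₁ = T₂ T₁ T₂` on `H^{⊗3}`. -/
def IsBraided (T : Module.End ℂ (H ⊗[ℂ] H)) : Prop :=
  legs T 2 0 * legs T 2 1 * legs T 2 0 = legs T 2 1 * legs T 2 0 * legs T 2 1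

/-- The operator `R_{n+1} = 1 + T₁ + T₁ T₂ + ⋯ + T₁ T₂ ⋯ Tₙ` on `H^{⊗(n+1)}`. -/
def fockR (T : Module.End ℂ (H ⊗[ℂ] H)) (n : ℕ) : Module.End ℂ (⨂[ℂ]^(n + 1) H) :=
  rElt (legs T n)

/-- The operators `P_n` on `H^{⊗n}` that give the Fock inner product:
`P_{n+1} = (1 ⊗ P_n) R_{n+1}`, started with `P_0 = 1`, so that `P_1 = 1` and `P_2 = R_2`. -/
def fockP (T : Module.End ℂ (H ⊗[ℂ] H)) : (n : ℕ) → Module.End ℂ (⨂[ℂ]^n H)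
  | 0 => 1
  | n + 1 => (consEquiv n).conj (LinearMap.lTensor H (fockP T n)) * fockR T n

end Tensor

end Wick

end

/-!
Let `t₁, …, tₙ` be a braided family of self-adjoint contractions. Extended to permutations along
reduced words, it turns `P_{n+1}` into the sum of the operators of all permutations of `n + 1`
strands. Reversal of words shows that `P_{n+1}` is self-adjoint (`isSelfAdjoint_symmetrizer`), and
for every splitting `k + l = n + 1` the sum factors as `P_{k+l} = (P_k ⊗ P_l) B_{k,l}`, where
`B_{k,l}` sums over the shuffles (`symmetrizer_add`). The factorization for a block of two strands
gives `1 + t_i ∣ P_{n+1}`, so that `ker P_{n+1}` contains every `ker (1 + t_i)`.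

For the converse let `x ∈ ker P_{n+1}` be orthogonal to all these kernels. Write `w_k` for the
operator of the longest permutation of the first `k` strands. The shuffles satisfy the telescoping
identity `∑ (-1)^k w_k B_{k,n+1-k} = 0` (`sum_longest_mul_shuffle`). For `0 < k < n + 1` the vector
`B_{k,l} x` lies in `ker (P_k ⊗ P_l)`, which by induction on the number of strands is orthogonal to
every vector orthogonal to the kernels `ker (1 + t_i)` with `i ≠ k`; as `w_k` permutes these
kernels, `⟪x, w_k B_{k,l} x⟫ = 0`. Only the extreme terms survive, so
`‖x‖² = ± ⟪x, w_{n+1} x⟫`. Hence no factor of the contraction `w_{n+1}` shrinks `x`, and as `x` is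
orthogonal to the `-1`-eigenspaces, every `t_i` fixes `x` (`apply_eq_self_of_norm_le`). Therefore
`P_{n+1} x = (n + 1)! x`, and `x = 0` (`IsContractiveBraidSeq.inner_eq_zero`).

The statement on tensor powers is the finite-dimensional case. The coordinates with respect to an
orthonormal basis of `H` make `H^{⊗m}` a Hilbert space on which `1 ⊗ T ⊗ 1` is unitarily
equivalent to a tensor product of `T` with identities, so it is a self-adjoint contraction. The
braid relations for the legs follow from the one on `H^{⊗3}` by adding strands on the left and on
the right, and `ker (1 + 1 ⊗ T ⊗ 1) = H^{⊗k} ⊗ ker (1 + T) ⊗ H^{⊗l}` by flatness.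
-/

namespace Wick

/-! ### Symmetrizers and shuffles for a braided sequence -/

section BraidSequence

variable {A : Type*} [Ring A]

/-- The braid relations for a sequence of ring elements. A finite family is treated as a sequence
that vanishes beyond its last index, which keeps the relations and lets intervals of generators
be addressed by an offset. -/
structure IsBraidSeq (s : ℕ → A) : Prop where
  braid : ∀ i, s i * s (i + 1) * s i = s (i + 1) * s i * s (i + 1)
  comm : ∀ i j, i + 2 ≤ j → Commute (s i) (s j)

/-- The descending product `s (a + k - 1) ⋯ s (a + 1) * s a` of `k` factors. -/
def descProd (s : ℕ → A) (a : ℕ) : ℕ → A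
  | 0 => 1
  | k + 1 => s (a + k) * descProd s a k

/-- The ascending product `s a * s (a + 1) ⋯ s (a + k - 1)` of `k` factors. -/
def ascProd (s : ℕ → A) (a : ℕ) : ℕ → A
  | 0 => 1
  | k + 1 => ascProd s a k * s (a + k)

/-- The sum of the descending products with at most `m` factors; the reversal of `rElt`. -/
def descSum (s : ℕ → A) (a : ℕ) : ℕ → A
  | 0 => 1
  | m + 1 => descSum s a m + descProd s a (m + 1)

/-- The symmetrizer on the `m` strands `a, …, a + m - 1`: the sum over the permutations of these
strands of the products along reduced words. The recursion is the reversal of the one that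
defines `pElt`. -/
def symmetrizer (s : ℕ → A) : ℕ → ℕ → A
  | _, 0 => 1
  | a, m + 1 => descSum s a m * symmetrizer s (a + 1) m

/-- The shuffle element on `k + l` strands starting at strand `a`: the sum over the minimal-length
representatives of the right cosets of `S_k × S_l` in `S_{k+l}`, given by its `q`-Pascal
recursion. -/
def shuffle (s : ℕ → A) : ℕ → ℕ → ℕ → A
  | _, 0, _ => 1
  | _, _ + 1, 0 => 1
  | a, k + 1, l + 1 =>
    shuffle s (a + 1) k (l + 1) + descProd s a (k + 1) * shuffle s (a + 1) (k + 1) l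
termination_by _ k l => k + l

/-- The element attached to the longest permutation of the `k` strands `a, …, a + k - 1`. -/
def longest (s : ℕ → A) (a : ℕ) : ℕ → A
  | 0 => 1
  | k + 1 => longest s a k * descProd s a k

variable {s : ℕ → A}

@[simp] theorem shuffle_zero_left (a l : ℕ) : shuffle s a 0 l = 1 := by
  rw [shuffle]

@[simp] theorem shuffle_zero_right (a k : ℕ) : shuffle s a k 0 = 1 := by
  cases k <;> rw [shuffle]

theorem shuffle_succ_succ (a k l : ℕ) : shuffle s a (k + 1) (l + 1) =
    shuffle s (a + 1) k (l + 1) + descProd s a (k + 1) * shuffle s (a + 1) (k + 1) l := by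
  rw [shuffle]

theorem descProd_add (a k i : ℕ) :
    descProd s a (k + i) = descProd s (a + k) i * descProd s a k := by
  induction i with
  | zero => simp [descProd]
  | succ i ih => rw [← add_assoc, descProd, ih, descProd, mul_assoc, add_assoc]

theorem descSum_add (a k l : ℕ) : descSum s a (k + l + 1) =
    descSum s a k + descSum s (a + k + 1) l * descProd s a (k + 1) := by
  induction l with
  | zero => simp [descSum]
  | succ l ih =>
    rw [← add_assoc, descSum, ih, descSum, add_mul, ← add_assoc,
      show k + l + 1 + 1 = (k + 1) + (l + 1) by ring, descProd_add a (k + 1) (l + 1),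
      ← add_assoc a k 1]

theorem semiconjBy_descProd {x : A} {a b : ℕ} (k : ℕ)
    (h : ∀ i < k, SemiconjBy x (s (b + i)) (s (a + i))) :
    SemiconjBy x (descProd s b k) (descProd s a k) := by
  induction k with
  | zero => exact SemiconjBy.one_right x
  | succ k ih => exact (h k (by omega)).mul_right (ih fun i hi => h i (by omega))

theorem semiconjBy_descSum {x : A} {a b : ℕ} (k : ℕ)
    (h : ∀ i < k, SemiconjBy x (s (b + i)) (s (a + i))) :
    SemiconjBy x (descSum s b k) (descSum s a k) := by
  induction k with
  | zero => exact SemiconjBy.one_right x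
  | succ k ih => exact (ih fun i hi => h i (by omega)).add_right (semiconjBy_descProd _ h)

/-- An element that carries the generators of one interval to those of another carries the
symmetrizer of the first to that of the second. -/
theorem semiconjBy_symmetrizer {x : A} {a b : ℕ} (m : ℕ)
    (h : ∀ i, i + 1 < m → SemiconjBy x (s (b + i)) (s (a + i))) :
    SemiconjBy x (symmetrizer s b m) (symmetrizer s a m) := by
  induction m generalizing a b with
  | zero => rw [symmetrizer, symmetrizer]; exact SemiconjBy.one_right x
  | succ m ih =>
    rw [symmetrizer, symmetrizer]
    refine (semiconjBy_descSum m fun i hi => h i (by omega)).mul_right (ih fun i hi => ?_)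
    have := h (i + 1) (by omega)
    rwa [show b + (i + 1) = b + 1 + i by ring, show a + (i + 1) = a + 1 + i by ring] at this

theorem commute_descProd {x : A} {a : ℕ} (k : ℕ) (h : ∀ i < k, Commute x (s (a + i))) :
    Commute x (descProd s a k) :=
  semiconjBy_descProd k h

theorem commute_longest {x : A} {a : ℕ} (k : ℕ) (h : ∀ i, i + 1 < k → Commute x (s (a + i))) :
    Commute x (longest s a k) := by
  induction k with
  | zero => exact Commute.one_right x
  | succ k ih =>
    exact (ih fun i hi => h i (by omega)).mul_right
      (commute_descProd k fun i hi => h i (by omega))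

namespace IsBraidSeq

variable (hs : IsBraidSeq s)

include hs

theorem comm' {i j : ℕ} (h : i + 2 ≤ j ∨ j + 2 ≤ i) : Commute (s i) (s j) :=
  h.elim (hs.comm i j) fun h => (hs.comm j i h).symm

/-- A descending product moves the generators under it down by one strand. -/
theorem semiconjBy_descProd_succ (a : ℕ) {k i : ℕ} (hi : i < k) :
    SemiconjBy (descProd s a (k + 1)) (s (a + i + 1)) (s (a + i)) := by
  induction k with
  | zero => omega
  | succ k ih =>
    rcases Nat.lt_succ_iff_lt_or_eq.mp hi with h | rfl
    · exact SemiconjBy.mul_left (hs.comm' (Or.inr (by omega))) (ih h)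
    · have h1 : Commute (descProd s a i) (s (a + i + 1)) :=
        (commute_descProd i fun j hj => hs.comm' (Or.inr (by omega))).symm
      have h2 : SemiconjBy (s (a + i + 1) * s (a + i)) (s (a + i + 1)) (s (a + i)) := by
        rw [SemiconjBy, ← hs.braid, mul_assoc]
      have := SemiconjBy.mul_left h2 h1
      rwa [mul_assoc] at this

/-- An ascending product moves the generators under it up by one strand. -/
theorem semiconjBy_ascProd_succ (a : ℕ) {k i : ℕ} (hi : i < k) :
    SemiconjBy (ascProd s a (k + 1)) (s (a + i)) (s (a + i + 1)) := by
  induction k with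
  | zero => omega
  | succ k ih =>
    rcases Nat.lt_succ_iff_lt_or_eq.mp hi with h | rfl
    · exact SemiconjBy.mul_left (ih h) (hs.comm' (Or.inr (by omega)))
    · have h1 : Commute (ascProd s a i) (s (a + i + 1)) := by
        clear ih hi
        have : ∀ j ≤ i, Commute (ascProd s a j) (s (a + i + 1)) := by
          intro j
          induction j with
          | zero => intro _; exact Commute.one_left _
          | succ j ih =>
            intro hj
            exact (ih (by omega)).mul_left (hs.comm' (Or.inl (by omega)))
        exact this i le_rfl
      have h2 : SemiconjBy (s (a + i) * s (a + i + 1)) (s (a + i)) (s (a + i + 1)) := by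
        rw [SemiconjBy, hs.braid, mul_assoc]
      have := SemiconjBy.mul_left h1 h2
      rwa [← mul_assoc] at this

theorem longest_succ_eq_ascProd_mul (a k : ℕ) :
    longest s a (k + 1) = ascProd s a k * longest s a k := by
  induction k with
  | zero => simp [longest, ascProd, descProd]
  | succ k ih =>
    have h : Commute (s (a + k)) (longest s a k) :=
      commute_longest k fun i hi => hs.comm' (Or.inr (by omega))
    calc longest s a (k + 1) * (s (a + k) * descProd s a k)
        = ascProd s a k * (longest s a k * s (a + k)) * descProd s a k := by
          rw [ih]; simp only [mul_assoc]
      _ = ascProd s a k * s (a + k) * (longest s a k * descProd s a k) := by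
          rw [← h.eq]; simp only [mul_assoc]

/-- The longest element reverses the order of the generators. -/
theorem semiconjBy_longest (a : ℕ) {k i j : ℕ} (h : i + j + 2 = k) :
    SemiconjBy (longest s a k) (s (a + i)) (s (a + j)) := by
  induction k generalizing i j with
  | zero => omega
  | succ k ih =>
    obtain ⟨k, rfl⟩ : ∃ k', k = k' + 1 := ⟨k - 1, by omega⟩
    cases i with
    | succ i =>
      rw [longest]
      exact SemiconjBy.mul_left (ih (by omega)) (hs.semiconjBy_descProd_succ a (by omega))
    | zero =>
      cases j with
      | zero =>
        obtain rfl : k = 0 := by omega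
        simp only [longest, descProd, one_mul, mul_one]
        exact Commute.refl _
      | succ j =>
        rw [hs.longest_succ_eq_ascProd_mul]
        exact SemiconjBy.mul_left (hs.semiconjBy_ascProd_succ a (by omega)) (ih (by omega))

/-- Symmetrizers of neighbouring disjoint blocks of strands commute. -/
theorem commute_symmetrizer (a k l : ℕ) : Commute (symmetrizer s a k) (symmetrizer s (a + k) l) :=
  semiconjBy_symmetrizer l fun i _ =>
    (semiconjBy_symmetrizer k fun j _ => hs.comm' (Or.inr (by omega)) :
      Commute (s (a + k + i)) (symmetrizer s a k)).symm

/-- The coset factorization of the symmetrizer along `S_k × S_l ⊆ S_{k+l}`. -/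
theorem symmetrizer_add (a k l : ℕ) :
    symmetrizer s a (k + l) = symmetrizer s a k * symmetrizer s (a + k) l * shuffle s a k l := by
  induction hm : k + l generalizing a k l with
  | zero =>
    obtain ⟨rfl, rfl⟩ : k = 0 ∧ l = 0 := by omega
    simp [symmetrizer]
  | succ m ih =>
    rcases k with _ | k
    · obtain rfl : l = m + 1 := by omega
      simp [symmetrizer]
    rcases l with _ | l
    · obtain rfl : k = m := by omega
      simp [symmetrizer]
    have h1 := ih (a + 1) k (l + 1) (by omega)
    have h2 := ih (a + 1) (k + 1) l (by omega)
    rw [show a + 1 + k = a + (k + 1) by ring] at h1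
    rw [show a + 1 + (k + 1) = a + (k + 1) + 1 by ring] at h2
    -- `c1` and `c2` are far commutations, `c3` slides the long crossing through the `k`-block.
    have c1 : Commute (symmetrizer s a (k + 1)) (descSum s (a + (k + 1)) l) :=
      semiconjBy_descSum l fun i _ =>
        (semiconjBy_symmetrizer (k + 1) fun j _ => hs.comm' (Or.inr (by omega)) :
          Commute (s (a + (k + 1) + i)) (symmetrizer s a (k + 1))).symm
    have c2 : Commute (descProd s a (k + 1)) (symmetrizer s (a + (k + 1) + 1) l) :=
      semiconjBy_symmetrizer l fun i _ =>
        (commute_descProd (k + 1) fun j _ => hs.comm' (Or.inr (by omega)) :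
          Commute (s (a + (k + 1) + 1 + i)) (descProd s a (k + 1))).symm
    have c3 : descProd s a (k + 1) * symmetrizer s (a + 1) (k + 1) =
        symmetrizer s a (k + 1) * descProd s a (k + 1) :=
      semiconjBy_symmetrizer (k + 1) fun i hi => by
        rw [add_right_comm]; exact hs.semiconjBy_descProd_succ a (by omega)
    obtain rfl : m = k + l + 1 := by omega
    have e1 : descSum s a k * symmetrizer s (a + 1) (k + l + 1) =
        symmetrizer s a (k + 1) * symmetrizer s (a + (k + 1)) (l + 1) *
          shuffle s (a + 1) k (l + 1) := by
      rw [h1, symmetrizer.eq_2 s a k]; simp only [mul_assoc]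
    have e2 : descSum s (a + (k + 1)) l * descProd s a (k + 1) * symmetrizer s (a + 1) (k + l + 1) =
        symmetrizer s a (k + 1) * symmetrizer s (a + (k + 1)) (l + 1) *
          (descProd s a (k + 1) * shuffle s (a + 1) (k + 1) l) := by
      calc _ = descSum s (a + (k + 1)) l * (descProd s a (k + 1) * symmetrizer s (a + 1) (k + 1)) *
            symmetrizer s (a + (k + 1) + 1) l * shuffle s (a + 1) (k + 1) l := by
            rw [h2]; simp only [mul_assoc]
        _ = (symmetrizer s a (k + 1) * descSum s (a + (k + 1)) l) *
            (descProd s a (k + 1) * symmetrizer s (a + (k + 1) + 1) l) *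
            shuffle s (a + 1) (k + 1) l := by
            rw [c3, c1.eq]; simp only [mul_assoc]
        _ = _ := by
            rw [c2.eq, symmetrizer.eq_2 s (a + (k + 1)) l]; simp only [mul_assoc]
    rw [symmetrizer, descSum_add, add_mul, shuffle_succ_succ, mul_add, ← e1, ← e2]
    rfl

end IsBraidSeq

/-- The alternating sum of shuffles, weighted by longest elements, vanishes: by the Pascal
recursion it telescopes. It expresses the longest element on `m + 1` strands through the identity
and shuffles along proper splittings. -/
theorem sum_longest_mul_shuffle (a m : ℕ) :
    ∑ k ∈ Finset.range (m + 2), (-1) ^ k * (longest s a k * shuffle s a k (m + 1 - k)) = 0 := by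
  have h : ∀ j ≤ m, ∑ k ∈ Finset.range (j + 1),
      (-1) ^ k * (longest s a k * shuffle s a k (m + 1 - k)) =
        (-1) ^ j * (longest s a (j + 1) * shuffle s (a + 1) j (m - j)) := by
    intro j
    induction j with
    | zero => simp [longest, descProd]
    | succ j ih =>
      intro hj
      obtain ⟨d, rfl⟩ : ∃ d, m = j + 1 + d := ⟨m - (j + 1), by omega⟩
      rw [Finset.sum_range_succ, ih (by omega), show j + 1 + d + 1 - (j + 1) = d + 1 by omega,
        show j + 1 + d - j = d + 1 by omega, show j + 1 + d - (j + 1) = d by omega,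
        shuffle_succ_succ, longest.eq_2 s a (j + 1), pow_succ]
      simp only [mul_add, mul_assoc, mul_neg, neg_mul, one_mul]
      abel
  rw [Finset.sum_range_succ, h m le_rfl]
  simp [pow_succ]

end BraidSequence

/-! ### The elements `P_{n+1}` as symmetrizers -/

section Symmetrizer

variable {A : Type*} [Ring A] {s : ℕ → A}

theorem rElt_succ {n : ℕ} (t : Fin (n + 1) → A) : rElt t = 1 + t 0 * rElt (Fin.tail t) := by
  rw [rElt, Finset.sum_range_succ', rElt, Finset.mul_sum, add_comm]
  simp [List.ofFn_succ, Fin.tail_def]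

theorem rElt_eq_shuffle (a n : ℕ) : rElt (fun i : Fin n => s (a + i)) = shuffle s a 1 n := by
  induction n generalizing a with
  | zero => simp [rElt]
  | succ n ih =>
    rw [rElt_succ, shuffle_succ_succ, shuffle_zero_left, ← ih (a + 1)]
    simp [descProd, Fin.tail_def, add_assoc, add_comm 1]

/-- The element `P_{n+1}` of an interval of `n` generators is the symmetrizer of `n + 1`
strands. -/
theorem IsBraidSeq.pElt_eq_symmetrizer (hs : IsBraidSeq s) (a n : ℕ) :
    pElt n (fun i : Fin n => s (a + i)) = symmetrizer s a (n + 1) := by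
  induction n generalizing a with
  | zero => simp [pElt, symmetrizer, descSum]
  | succ n ih =>
    have h : symmetrizer s a 1 = 1 := by simp [symmetrizer, descSum]
    rw [add_comm (n + 1) 1, hs.symmetrizer_add a 1 (n + 1), h, one_mul, ← ih (a + 1), pElt,
      rElt_eq_shuffle]
    simp [Fin.tail_def, add_assoc, add_comm 1]

/-- The symmetrizer is divisible on the left by `1 + s_i` for each of its generators `s_i`. -/
theorem IsBraidSeq.one_add_dvd_symmetrizer (hs : IsBraidSeq s) (a : ℕ) {m i : ℕ}
    (hi : i + 1 < m) : 1 + s (a + i) ∣ symmetrizer s a m := by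
  have h2 (b : ℕ) : symmetrizer s b 2 = 1 + s b := by simp [symmetrizer, descSum, descProd]
  obtain ⟨d, rfl⟩ : ∃ d, m = i + (2 + d) := ⟨m - i - 2, by omega⟩
  rw [hs.symmetrizer_add a i (2 + d), (hs.commute_symmetrizer a i (2 + d)).eq,
    hs.symmetrizer_add (a + i) 2 d, h2]
  simp only [mul_assoc]
  exact dvd_mul_right _ _

/-- The involution fixes the symmetrizer when it fixes the generators. -/
theorem IsBraidSeq.isSelfAdjoint_symmetrizer [StarRing A] (hs : IsBraidSeq s)
    (h : ∀ i, IsSelfAdjoint (s i)) (a m : ℕ) : IsSelfAdjoint (symmetrizer s a m) := by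
  have h1 (a m : ℕ) : star (descSum s a m) = shuffle s a 1 m := by
    have hd (a k : ℕ) : star (descProd s a (k + 1)) = s a * star (descProd s (a + 1) k) := by
      rw [add_comm k 1, descProd_add]
      simp [descProd, (h _).star_eq]
    have hc (a m : ℕ) : star (descSum s a (m + 1)) = 1 + s a * star (descSum s (a + 1) m) := by
      induction m with
      | zero => simp [descSum, descProd, (h _).star_eq]
      | succ m ih => rw [descSum, star_add, ih, hd, descSum, star_add, mul_add, add_assoc]
    induction m generalizing a with
    | zero => simp [descSum]
    | succ m ih => rw [hc, ih, shuffle_succ_succ]; simp [descProd]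
  induction m generalizing a with
  | zero => simp [symmetrizer, IsSelfAdjoint]
  | succ m ih =>
    have h0 : symmetrizer s a 1 = 1 := by simp [symmetrizer, descSum]
    rw [IsSelfAdjoint]
    conv_rhs => rw [add_comm m 1, hs.symmetrizer_add a 1 m, h0, one_mul]
    rw [symmetrizer, star_mul, h1, (ih (a + 1)).star_eq]

end Symmetrizer

/-! ### Braided sequences of self-adjoint contractions -/

section Hilbert

variable {K : Type*} [NormedAddCommGroup K] [InnerProductSpace ℂ K] [CompleteSpace K]

local notation "⟪" x ", " y "⟫" => inner ℂ x y

theorem _root_.IsSelfAdjoint.inner_map_left {S : K →L[ℂ] K} (hS : IsSelfAdjoint S) (x y : K) :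
    ⟪S x, y⟫ = ⟪x, S y⟫ :=
  hS.isSymmetric x y

/-- A self-adjoint contraction that does not shrink a vector orthogonal to its `-1`-eigenspace
fixes that vector: it squares to the identity on the vector, and `x - S x` lies in the
eigenspace. -/
theorem apply_eq_self_of_norm_le {S : K →L[ℂ] K} (hS : IsSelfAdjoint S) (hn : ‖S‖ ≤ 1) {x : K}
    (hx : ∀ u, u + S u = 0 → ⟪x, u⟫ = 0) (hle : ‖x‖ ≤ ‖S x‖) : S x = x := by
  have hc (y : K) : ‖S y‖ ≤ ‖y‖ := by simpa using S.le_of_opNorm_le hn y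
  have hsq : S (S x) = x := by
    rw [← sub_eq_zero, ← norm_eq_zero, ← sq_eq_zero_iff]
    have h1 : ‖S (S x) - x‖ ^ 2 = ‖S (S x)‖ ^ 2 - 2 * ‖S x‖ ^ 2 + ‖x‖ ^ 2 := by
      rw [@norm_sub_sq ℂ, hS.inner_map_left, inner_self_eq_norm_sq]
    have h2 : ‖S (S x)‖ ≤ ‖x‖ := (hc _).trans (hc _)
    nlinarith [norm_nonneg (S (S x)), norm_nonneg x, sq_nonneg ‖S (S x) - x‖]
  have h0 : ⟪x, x - S x⟫ = 0 := hx _ (by rw [map_sub, hsq]; abel)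
  have h1 : ⟪S x, x - S x⟫ = 0 := by
    rw [hS.inner_map_left, map_sub, hsq, ← neg_sub, inner_neg_right, h0, neg_zero]
  have h2 : ⟪x - S x, x - S x⟫ = 0 := by rw [inner_sub_left, h0, h1, sub_zero]
  exact (sub_eq_zero.mp (inner_self_eq_zero.mp h2)).symm

/-- A vector orthogonal to the kernels of two commuting operators, the first of them
self-adjoint, is orthogonal to the kernel of their product. -/
theorem inner_eq_zero_of_commute {P Q : K →L[ℂ] K} (hP : IsSelfAdjoint P)
    (hc : Commute P Q) {v : K} (hvP : ∀ z, P z = 0 → ⟪v, z⟫ = 0)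
    (hvQ : ∀ z, Q z = 0 → ⟪v, z⟫ = 0) {z : K} (hz : P (Q z) = 0) : ⟪v, z⟫ = 0 := by
  have hcx (w : K) : P (Q w) = Q (P w) := DFunLike.congr_fun hc.eq w
  let L : Submodule ℂ K := LinearMap.ker (Q : K →ₗ[ℂ] K)
  have hL : ∀ w, w ∈ L ↔ Q w = 0 := fun w => LinearMap.mem_ker
  have : CompleteSpace L := (Q.isClosed_ker).completeSpace_coe
  obtain ⟨z₁, h₁, z₂, h₂, rfl⟩ := L.exists_add_mem_mem_orthogonal z
  rw [map_add, (hL z₁).1 h₁, zero_add] at hz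
  -- `P` preserves the kernel `L` of `Q`, hence also `Lᗮ`, so `P z₂` lies in both.
  have h3 : P z₂ ∈ L := by rw [hL, ← hcx, hz]
  have h4 : P z₂ = 0 := by
    have : ⟪P (P z₂), z₂⟫ = 0 := h₂ _ (by rw [hL, ← hcx, (hL _).1 h3, map_zero])
    rwa [hP.inner_map_left, inner_self_eq_zero] at this
  rw [inner_add_right, hvQ z₁ ((hL _).1 h₁), hvP z₂ h4, add_zero]

/-- Braided sequences of self-adjoint contractions. -/
structure IsContractiveBraidSeq (s : ℕ → K →L[ℂ] K) : Prop extends IsBraidSeq s where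
  isSelfAdjoint : ∀ i, IsSelfAdjoint (s i)
  norm_le : ∀ i, ‖s i‖ ≤ 1

/-- The sum of the kernels of `1 + s_i` over the generators `s_i` on the `m` strands from `a`. -/
def kerSum (s : ℕ → K →L[ℂ] K) (a m : ℕ) : Submodule ℂ K :=
  ⨆ (i : ℕ) (_ : i + 1 < m), LinearMap.ker (1 + s (a + i) : K →L[ℂ] K).toLinearMap

omit [CompleteSpace K] in
theorem mem_orthogonal_kerSum {s : ℕ → K →L[ℂ] K} {a m : ℕ} {v : K} :
    v ∈ (kerSum s a m)ᗮ ↔ ∀ i, i + 1 < m → ∀ u, u + s (a + i) u = 0 → ⟪v, u⟫ = 0 := by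
  refine ⟨fun hv i hi u hu => ?_, fun h => ?_⟩
  · exact (Submodule.mem_orthogonal' _ _).1 hv u
      (Submodule.mem_iSup_of_mem i (Submodule.mem_iSup_of_mem hi hu))
  · have : kerSum s a m ≤ (ℂ ∙ v)ᗮ := iSup₂_le fun i hi u hu =>
      Submodule.mem_orthogonal_singleton_iff_inner_right.2 (h i hi u hu)
    exact (Submodule.mem_orthogonal' _ _).2 fun u hu =>
      Submodule.mem_orthogonal_singleton_iff_inner_right.1 (this hu)

namespace IsContractiveBraidSeq

variable {s : ℕ → K →L[ℂ] K}

theorem kerSum_le_ker (hs : IsContractiveBraidSeq s) (a m : ℕ) :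
    kerSum s a m ≤ LinearMap.ker (symmetrizer s a m).toLinearMap := by
  refine iSup₂_le fun i hi u hu => ?_
  have hu' : (1 + s (a + i)) u = 0 := hu
  obtain ⟨c, hc⟩ := hs.one_add_dvd_symmetrizer a hi
  have h : symmetrizer s a m = star c * (1 + s (a + i)) := by
    rw [← (hs.isSelfAdjoint_symmetrizer hs.isSelfAdjoint a m).star_eq, hc, star_mul, star_add,
      star_one, (hs.isSelfAdjoint _).star_eq]
  change symmetrizer s a m u = 0
  rw [h, mul_apply_eq_comp, hu', map_zero]

theorem norm_apply_le (hs : IsContractiveBraidSeq s) (i : ℕ) (x : K) : ‖s i x‖ ≤ ‖x‖ := by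
  simpa using (s i).le_of_opNorm_le (hs.norm_le i) x

theorem norm_descProd_apply_le (hs : IsContractiveBraidSeq s) (a k : ℕ) (x : K) :
    ‖descProd s a k x‖ ≤ ‖x‖ := by
  induction k with
  | zero => simp [descProd]
  | succ k ih => exact (hs.norm_apply_le _ _).trans ih

theorem norm_longest_apply_le (hs : IsContractiveBraidSeq s) (a k : ℕ) (x : K) :
    ‖longest s a k x‖ ≤ ‖x‖ := by
  induction k generalizing x with
  | zero => simp [longest]
  | succ k ih => exact (ih _).trans (hs.norm_descProd_apply_le _ _ _)

/-- If the longest element does not shrink a vector orthogonal to all the kernels, then every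
generator fixes this vector. -/
theorem descProd_apply_eq_self (hs : IsContractiveBraidSeq s) {a m : ℕ} {x : K}
    (hx : x ∈ (kerSum s a (m + 1))ᗮ) (hle : ‖x‖ ≤ ‖longest s a (m + 1) x‖) {k : ℕ} (hk : k ≤ m) :
    descProd s a k x = x := by
  induction k with
  | zero => simp [descProd]
  | succ k ih =>
    have h1 : descProd s a (k + 1) x = s (a + k) x := by
      rw [descProd, mul_apply_eq_comp, ih (by omega)]
    obtain ⟨d, rfl⟩ : ∃ d, m = k + 1 + d := ⟨m - (k + 1), by omega⟩
    have h2 : ‖x‖ ≤ ‖s (a + k) x‖ := by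
      refine hle.trans ((hs.norm_longest_apply_le a (k + 1 + d) (descProd s a _ x)).trans ?_)
      rw [descProd_add, mul_apply_eq_comp, h1]
      exact hs.norm_descProd_apply_le _ _ _
    rw [h1]
    exact apply_eq_self_of_norm_le (hs.isSelfAdjoint _) (hs.norm_le _)
      (mem_orthogonal_kerSum.1 hx k (by omega)) h2

/-- The adjoint of the longest element on `k` strands preserves the vectors orthogonal to the
kernels of `1 + s_i`, as the longest element permutes these kernels. -/
theorem adjoint_longest_mem (hs : IsContractiveBraidSeq s) {a k : ℕ} {v : K}
    (hv : v ∈ (kerSum s a k)ᗮ) : (longest s a k).adjoint v ∈ (kerSum s a k)ᗮ := by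
  rw [mem_orthogonal_kerSum] at hv ⊢
  intro i hi u hu
  rw [ContinuousLinearMap.adjoint_inner_left]
  refine hv (k - 2 - i) (by omega) _ ?_
  have h := DFunLike.congr_fun
    (hs.semiconjBy_longest a (k := k) (i := i) (j := k - 2 - i) (by omega)).eq u
  simp only [mul_apply_eq_comp] at h
  rw [← h, ← map_add, hu, map_zero]

/-- The longest element on a block of strands commutes with the generators of a later block. -/
theorem adjoint_longest_mem_of_later (hs : IsContractiveBraidSeq s) {a k l : ℕ} {v : K}
    (hv : v ∈ (kerSum s (a + k) l)ᗮ) : (longest s a k).adjoint v ∈ (kerSum s (a + k) l)ᗮ := by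
  rw [mem_orthogonal_kerSum] at hv ⊢
  intro i hi u hu
  rw [ContinuousLinearMap.adjoint_inner_left]
  refine hv i hi _ ?_
  have h := DFunLike.congr_fun (commute_longest k fun j _ => hs.comm' (Or.inr (by omega)) :
    Commute (s (a + k + i)) (longest s a k)).eq u
  simp only [mul_apply_eq_comp] at h
  rw [h, ← map_add, hu, map_zero]

omit [CompleteSpace K] in
theorem descSum_apply (m : ℕ) {a : ℕ} {x : K} (h : ∀ k ≤ m, descProd s a k x = x) :
    descSum s a m x = ((m + 1 : ℕ) : ℂ) • x := by
  induction m with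
  | zero => simp [descSum]
  | succ m ih =>
    rw [descSum, add_apply, ih fun k hk => h k (by omega), h _ le_rfl]
    push_cast
    module

omit [CompleteSpace K] in
/-- A vector fixed by all generators is an eigenvector of the symmetrizer, with eigenvalue the
number of permutations. -/
theorem symmetrizer_apply (m : ℕ) {a : ℕ} {x : K} (h : ∀ i, i + 1 < m → s (a + i) x = x) :
    symmetrizer s a m x = (m.factorial : ℂ) • x := by
  induction m generalizing a with
  | zero => simp [symmetrizer]
  | succ m ih =>
    have hd : ∀ k ≤ m, descProd s a k x = x := by
      intro k
      induction k with
      | zero => intro _; simp [descProd]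
      | succ k ih =>
        intro hk
        rw [descProd, mul_apply_eq_comp, ih (by omega), h k (by omega)]
    have h' : ∀ i, i + 1 < m → s (a + 1 + i) x = x := fun i hi => by
      rw [add_assoc, add_comm 1 i]; exact h (i + 1) (by omega)
    rw [symmetrizer, mul_apply_eq_comp, ih h', map_smul, descSum_apply m hd, smul_smul,
      Nat.factorial_succ, mul_comm]
    push_cast
    rfl

/-- The kernel of the symmetrizer is orthogonal to every vector orthogonal to the kernels of the
operators `1 + s_i`. -/
theorem inner_eq_zero (hs : IsContractiveBraidSeq s) (m : ℕ) {a : ℕ} {v z : K}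
    (hv : v ∈ (kerSum s a m)ᗮ) (hz : symmetrizer s a m z = 0) : ⟪v, z⟫ = 0 := by
  induction m using Nat.strong_induction_on generalizing a v z with
  | _ m ih =>
  have key : ∀ x ∈ (kerSum s a m)ᗮ, symmetrizer s a m x = 0 → x = 0 := by
    intro x hx hPx
    rcases m with _ | m
    · simpa [symmetrizer] using hPx
    -- Shuffles along proper splittings send `x` into a space that is orthogonal to `x`.
    have hmid : ∀ k ∈ Finset.Ico 1 (m + 1),
        ⟪x, longest s a k (shuffle s a k (m + 1 - k) x)⟫ = 0 := by
      intro k hk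
      rw [Finset.mem_Ico] at hk
      obtain ⟨l, rfl⟩ : ∃ l, m = k + l := ⟨m - k, by omega⟩
      rw [show k + l + 1 - k = l + 1 by omega]
      rw [add_assoc, hs.symmetrizer_add a k (l + 1)] at hPx
      rw [mem_orthogonal_kerSum] at hx
      have hx1 : x ∈ (kerSum s a k)ᗮ :=
        mem_orthogonal_kerSum.2 fun i hi => hx i (by omega)
      have hx2 : x ∈ (kerSum s (a + k) (l + 1))ᗮ :=
        mem_orthogonal_kerSum.2 fun i hi => by
          rw [add_assoc]; exact hx (k + i) (by omega)
      rw [← ContinuousLinearMap.adjoint_inner_left]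
      exact inner_eq_zero_of_commute
        (hs.isSelfAdjoint_symmetrizer hs.isSelfAdjoint _ _)
        (hs.commute_symmetrizer a k (l + 1))
        (fun z => ih k (by omega) (hs.adjoint_longest_mem hx1))
        (fun z => ih (l + 1) (by omega) (hs.adjoint_longest_mem_of_later hx2)) hPx
    have hsum := congrArg (fun S : K →L[ℂ] K => ⟪x, S x⟫) (sum_longest_mul_shuffle (s := s) a m)
    have hterm : ∀ k, ⟪x, ((-1 : K →L[ℂ] K) ^ k * (longest s a k * shuffle s a k (m + 1 - k))) x⟫
        = (-1 : ℂ) ^ k * ⟪x, longest s a k (shuffle s a k (m + 1 - k) x)⟫ := by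
      intro k
      rcases neg_one_pow_eq_or ℂ k with h | h <;>
      rcases Nat.even_or_odd k with h' | h' <;> simp [h'.neg_one_pow]
    simp only [sum_apply, inner_sum, hterm] at hsum
    rw [Finset.sum_range_succ, Finset.range_eq_Ico, Finset.sum_eq_sum_Ico_succ_bot (by omega),
      Finset.sum_eq_zero fun k hk => by rw [hmid k hk, mul_zero]] at hsum
    simp only [longest.eq_1, shuffle_zero_left, Nat.sub_self, shuffle_zero_right,
      one_apply_eq_self, pow_zero, one_mul, add_zero,
      zero_apply, inner_zero_right] at hsum
    -- `hsum` now reads `⟪x, x⟫ + (-1) ^ (m + 1) * ⟪x, longest s a (m + 1) x⟫ = 0`.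
    have hnorm : ‖x‖ ≤ ‖longest s a (m + 1) x‖ := by
      have h1 : ‖⟪x, x⟫‖ = ‖⟪x, longest s a (m + 1) x⟫‖ := by
        rw [eq_neg_of_add_eq_zero_left hsum]; simp
      have h2 := norm_inner_le_norm (𝕜 := ℂ) x (longest s a (m + 1) x)
      rw [← h1, inner_self_eq_norm_sq_to_K, norm_pow, RCLike.norm_ofReal, abs_norm, sq] at h2
      rcases (norm_nonneg x).eq_or_lt with h | h
      · rw [← h]; exact norm_nonneg _
      · exact le_of_mul_le_mul_left h2 h
    have hd := fun k (hk : k ≤ m) => hs.descProd_apply_eq_self hx hnorm hk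
    have hfix : ∀ i, i + 1 < m + 1 → s (a + i) x = x := fun i hi => by
      have := hd (i + 1) (by omega)
      rwa [descProd, mul_apply_eq_comp, hd i (by omega)] at this
    rw [symmetrizer_apply _ hfix] at hPx
    exact (smul_eq_zero.mp hPx).resolve_left (by exact_mod_cast Nat.factorial_ne_zero _)
  -- The kernel contains the closure `M` of the sum, and by `key` it meets `Mᗮ` trivially.
  let M := (kerSum s a m).topologicalClosure
  have hM : M ≤ LinearMap.ker (symmetrizer s a m).toLinearMap :=
    Submodule.topologicalClosure_minimal _ (hs.kerSum_le_ker a m)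
      (symmetrizer s a m).isClosed_ker
  have : CompleteSpace M := (Submodule.isClosed_topologicalClosure _).completeSpace_coe
  have hMo : Mᗮ = (kerSum s a m)ᗮ := Submodule.orthogonal_closure _
  obtain ⟨z₁, h₁, z₂, h₂, rfl⟩ := M.exists_add_mem_mem_orthogonal z
  have h₁' : symmetrizer s a m z₁ = 0 := hM h₁
  rw [map_add, h₁', zero_add] at hz
  rw [key z₂ (hMo ▸ h₂) hz, add_zero]
  exact Submodule.inner_left_of_mem_orthogonal h₁ (hMo ▸ hv)

theorem ker_symmetrizer (hs : IsContractiveBraidSeq s) (a m : ℕ) :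
    LinearMap.ker (symmetrizer s a m).toLinearMap = (kerSum s a m).topologicalClosure := by
  refine le_antisymm (fun z hz => ?_) (Submodule.topologicalClosure_minimal _
    (hs.kerSum_le_ker a m) (symmetrizer s a m).isClosed_ker)
  rw [← Submodule.orthogonal_orthogonal_eq_closure, Submodule.mem_orthogonal]
  exact fun v hv => hs.inner_eq_zero m hv hz

end IsContractiveBraidSeq

theorem ker_pElt {n : ℕ} {t : Fin n → K →L[ℂ] K} (hsa : ∀ k, IsSelfAdjoint (t k))
    (hn : ∀ k, ‖t k‖ ≤ 1) (ht : IsBraidFamily t) :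
    LinearMap.ker (pElt n t : K →L[ℂ] K).toLinearMap =
      (⨆ k : Fin n, LinearMap.ker (1 + t k : K →L[ℂ] K).toLinearMap).topologicalClosure := by
  let s : ℕ → K →L[ℂ] K := fun i => if h : i < n then t ⟨i, h⟩ else 0
  have hst (k : Fin n) : s (0 + k) = t k := by simp [s]
  have hs : IsContractiveBraidSeq s := by
    refine { braid := fun i => ?_, comm := fun i j hij => ?_, isSelfAdjoint := fun i => ?_,
             norm_le := fun i => ?_ }
    · by_cases h : i + 1 < n
      · simpa [s, h, show i < n by omega] using ht.braid ⟨i, by omega⟩ ⟨i + 1, h⟩ rfl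
      · simp [s, h]
    · by_cases h : j < n
      · have hi : i < n := by omega
        simp only [s, h, hi, dif_pos]
        exact ht.comm ⟨i, hi⟩ ⟨j, h⟩ hij
      · simp [s, h]
    · by_cases h : i < n <;> simp [s, h, hsa]
    · by_cases h : i < n <;> simp [s, h, hn]
  have h1 : pElt n t = symmetrizer s 0 (n + 1) := by
    rw [← hs.pElt_eq_symmetrizer 0 n]
    simp only [hst]
  have h2 : kerSum s 0 (n + 1) =
      ⨆ k : Fin n, LinearMap.ker (1 + t k : K →L[ℂ] K).toLinearMap := by
    refine le_antisymm (iSup₂_le fun i hi => ?_) (iSup_le fun k => ?_)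
    · exact le_iSup_of_le ⟨i, by omega⟩ (by rw [← hst])
    · rw [← hst]
      exact le_iSup₂_of_le (k : ℕ) (by omega) le_rfl
  rw [h1, hs.ker_symmetrizer, h2]

theorem ker_pElt_of_finiteDimensional [FiniteDimensional ℂ K] {n : ℕ} {t : Fin n → K →L[ℂ] K}
    (hsa : ∀ k, IsSelfAdjoint (t k)) (hn : ∀ k, ‖t k‖ ≤ 1) (ht : IsBraidFamily t) :
    LinearMap.ker (pElt n t : K →L[ℂ] K).toLinearMap =
      ⨆ k : Fin n, LinearMap.ker (1 + t k : K →L[ℂ] K).toLinearMap := by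
  rw [ker_pElt hsa hn ht]
  exact (Submodule.closed_of_finiteDimensional _).submodule_topologicalClosure_eq

end Hilbert

/-! ### Legs on tensor powers -/

noncomputable section TensorPowers

variable {H : Type*} [AddCommGroup H] [Module ℂ H]

open TensorPower (toTensorAlgebra)

/-- A tensor power embeds into the tensor algebra, so that identities between iterated products of
tensors reduce to associativity there, without casts between the degrees. -/
theorem toTensorAlgebra_injective (n : ℕ) :
    Function.Injective (toTensorAlgebra : (⨂[ℂ]^n H) →ₗ[ℂ] TensorAlgebra ℂ H) := by
  have h (x : ⨂[ℂ]^n H) : toTensorAlgebra x =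
      TensorAlgebra.equivDirectSum.symm (DirectSum.of (fun n => ⨂[ℂ]^n H) n x) :=
    (DirectSum.toAddMonoid_of
      (fun _ => LinearMap.toAddMonoidHom (toTensorAlgebra (R := ℂ) (M := H))) _ _).symm
  intro x y hxy
  rw [h, h] at hxy
  exact DirectSum.of_injective n (TensorAlgebra.equivDirectSum.symm.injective hxy)

@[simp] theorem toTensorAlgebra_cast {i j : ℕ} (h : i = j) (x : ⨂[ℂ]^i H) :
    toTensorAlgebra (TensorPower.cast ℂ H h x) = toTensorAlgebra x := by
  subst h; simp

@[simp] theorem toTensorAlgebra_mulEquiv {i j : ℕ} (x : ⨂[ℂ]^i H) (y : ⨂[ℂ]^j H) :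
    toTensorAlgebra (TensorPower.mulEquiv (x ⊗ₜ[ℂ] y)) =
      toTensorAlgebra x * toTensorAlgebra y :=
  TensorPower.toTensorAlgebra_gMul x y

theorem oneEquiv_apply (u : H) : oneEquiv u = PiTensorProduct.tprod ℂ fun _ : Fin 1 => u := by
  rw [oneEquiv, LinearEquiv.symm_apply_eq]
  simp

/-- The canonical identification `H^{⊗n} ⊗ H ≃ H^{⊗(n+1)}`. -/
def snocEquiv (n : ℕ) : (⨂[ℂ]^n H) ⊗[ℂ] H ≃ₗ[ℂ] (⨂[ℂ]^(n + 1) H) :=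
  (TensorProduct.congr (LinearEquiv.refl ℂ _) oneEquiv).trans TensorPower.mulEquiv

theorem toTensorAlgebra_consEquiv (n : ℕ) (u : H) (Z : ⨂[ℂ]^n H) :
    toTensorAlgebra (consEquiv n (u ⊗ₜ Z)) =
      toTensorAlgebra (oneEquiv u) * toTensorAlgebra Z := by
  simp [consEquiv]

theorem toTensorAlgebra_snocEquiv (n : ℕ) (u : H) (Z : ⨂[ℂ]^n H) :
    toTensorAlgebra (snocEquiv n (Z ⊗ₜ u)) =
      toTensorAlgebra Z * toTensorAlgebra (oneEquiv u) := by
  simp [snocEquiv]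

theorem toTensorAlgebra_twoEquiv (u v : H) : toTensorAlgebra (twoEquiv (u ⊗ₜ[ℂ] v)) =
    toTensorAlgebra (oneEquiv u) * toTensorAlgebra (oneEquiv v) :=
  toTensorAlgebra_mulEquiv (oneEquiv u) (oneEquiv v)

theorem toTensorAlgebra_placeEquiv {k l m : ℕ} (h : k + 2 + l = m) (X : ⨂[ℂ]^k H)
    (S : H ⊗[ℂ] H) (Y : ⨂[ℂ]^l H) : toTensorAlgebra (placeEquiv k l m h ((X ⊗ₜ S) ⊗ₜ Y)) =
      toTensorAlgebra X * toTensorAlgebra (twoEquiv S) * toTensorAlgebra Y := by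
  simp [placeEquiv]

theorem consEquiv_placeEquiv {k l m : ℕ} (h : k + 2 + l = m) (h' : k + 1 + 2 + l = m + 1) (u : H)
    (X : ⨂[ℂ]^k H) (S : H ⊗[ℂ] H) (Y : ⨂[ℂ]^l H) :
    consEquiv m (u ⊗ₜ placeEquiv k l m h ((X ⊗ₜ S) ⊗ₜ Y)) =
      placeEquiv (k + 1) l (m + 1) h' ((consEquiv k (u ⊗ₜ X) ⊗ₜ S) ⊗ₜ Y) := by
  apply toTensorAlgebra_injective
  simp only [toTensorAlgebra_consEquiv, toTensorAlgebra_placeEquiv, mul_assoc]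

theorem snocEquiv_placeEquiv {k l m : ℕ} (h : k + 2 + l = m) (h' : k + 2 + (l + 1) = m + 1)
    (u : H) (X : ⨂[ℂ]^k H) (S : H ⊗[ℂ] H) (Y : ⨂[ℂ]^l H) :
    snocEquiv m (placeEquiv k l m h ((X ⊗ₜ S) ⊗ₜ Y) ⊗ₜ u) =
      placeEquiv k (l + 1) (m + 1) h' ((X ⊗ₜ S) ⊗ₜ snocEquiv l (Y ⊗ₜ u)) := by
  apply toTensorAlgebra_injective
  simp only [toTensorAlgebra_snocEquiv, toTensorAlgebra_placeEquiv, mul_assoc]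

theorem consEquiv_consEquiv {l m : ℕ} (h : 0 + 2 + l = m + 1) (h' : l + 1 = m) (u v : H)
    (Z : ⨂[ℂ]^l H) :
    consEquiv m (u ⊗ₜ TensorPower.cast ℂ H h' (consEquiv l (v ⊗ₜ Z))) =
      placeEquiv 0 l (m + 1) h ((PiTensorProduct.tprod ℂ Fin.elim0 ⊗ₜ (u ⊗ₜ v)) ⊗ₜ Z) := by
  apply toTensorAlgebra_injective
  simp [toTensorAlgebra_consEquiv, toTensorAlgebra_placeEquiv, toTensorAlgebra_twoEquiv,
    mul_assoc]

/-- The algebra homomorphism `f ↦ 1 ⊗ f` from the operators on `H^{⊗m}` to those on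
`H^{⊗(m+1)}`. -/
def consEnd (m : ℕ) : Module.End ℂ (⨂[ℂ]^m H) →ₐ[ℂ] Module.End ℂ (⨂[ℂ]^(m + 1) H) :=
  ((consEquiv m).conjAlgEquiv ℂ).toAlgHom.comp (Module.End.lTensorAlgHom ℂ _ H)

/-- The algebra homomorphism `f ↦ f ⊗ 1` from the operators on `H^{⊗m}` to those on
`H^{⊗(m+1)}`. -/
def snocEnd (m : ℕ) : Module.End ℂ (⨂[ℂ]^m H) →ₐ[ℂ] Module.End ℂ (⨂[ℂ]^(m + 1) H) :=
  ((snocEquiv m).conjAlgEquiv ℂ).toAlgHom.comp (Module.End.rTensorAlgHom ℂ _ H)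

theorem consEnd_apply (m : ℕ) (f : Module.End ℂ (⨂[ℂ]^m H)) :
    consEnd m f = (consEquiv m).conj (LinearMap.lTensor H f) :=
  rfl

theorem consEnd_apply_consEquiv (m : ℕ) (f : Module.End ℂ (⨂[ℂ]^m H)) (u : H) (Z : ⨂[ℂ]^m H) :
    consEnd m f (consEquiv m (u ⊗ₜ Z)) = consEquiv m (u ⊗ₜ f Z) := by
  simp [consEnd_apply, LinearEquiv.conj_apply_apply]

theorem snocEnd_apply_snocEquiv (m : ℕ) (f : Module.End ℂ (⨂[ℂ]^m H)) (u : H) (Z : ⨂[ℂ]^m H) :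
    snocEnd m f (snocEquiv m (Z ⊗ₜ u)) = snocEquiv m (f Z ⊗ₜ u) := by
  have : snocEnd m f = (snocEquiv m).conj (LinearMap.rTensor H f) := rfl
  simp [this, LinearEquiv.conj_apply_apply]

variable (T : Module.End ℂ (H ⊗[ℂ] H))

theorem leg_placeEquiv {k l m : ℕ} (h : k + 2 + l = m) (X : ⨂[ℂ]^k H) (S : H ⊗[ℂ] H)
    (Y : ⨂[ℂ]^l H) : leg T k l m h (placeEquiv k l m h ((X ⊗ₜ S) ⊗ₜ Y)) =
      placeEquiv k l m h ((X ⊗ₜ T S) ⊗ₜ Y) := by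
  simp [leg, LinearEquiv.conj_apply_apply]

theorem placeEquiv_induction {k l m : ℕ} (h : k + 2 + l = m) {p : (⨂[ℂ]^m H) → Prop}
    (hz : p 0) (ha : ∀ x y, p x → p y → p (x + y))
    (ht : ∀ X S Y, p (placeEquiv k l m h ((X ⊗ₜ S) ⊗ₜ Y))) (x : ⨂[ℂ]^m H) : p x := by
  obtain ⟨q, rfl⟩ := (placeEquiv k l m h).surjective x
  induction q with
  | zero => rwa [map_zero]
  | add q r hq hr => rw [map_add]; exact ha _ _ hq hr
  | tmul q Y =>
    induction q with
    | zero => rwa [TensorProduct.zero_tmul, map_zero]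
    | add q r hq hr => rw [TensorProduct.add_tmul, map_add]; exact ha _ _ hq hr
    | tmul X S => exact ht X S Y

theorem consEquiv_ext {m : ℕ} {f g : Module.End ℂ (⨂[ℂ]^(m + 1) H)}
    (h : ∀ u Z, f (consEquiv m (u ⊗ₜ Z)) = g (consEquiv m (u ⊗ₜ Z))) : f = g := by
  refine LinearMap.ext fun x => ?_
  obtain ⟨q, rfl⟩ := (consEquiv m).surjective x
  induction q with
  | zero => simp only [map_zero]
  | add q r hq hr => simp only [map_add, hq, hr]
  | tmul u Z => exact h u Z

/-- Adding a strand on the left of a leg. -/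
theorem leg_succ_left {k l m : ℕ} (h : k + 2 + l = m) (h' : k + 1 + 2 + l = m + 1) :
    leg T (k + 1) l (m + 1) h' = consEnd m (leg T k l m h) := by
  refine consEquiv_ext fun u Z => ?_
  rw [consEnd_apply_consEquiv]
  induction Z using placeEquiv_induction h with
  | hz => simp
  | ha x y hx hy => simp only [TensorProduct.tmul_add, map_add, hx, hy]
  | ht X S Y =>
    rw [leg_placeEquiv, consEquiv_placeEquiv h h', consEquiv_placeEquiv h h', leg_placeEquiv]

/-- Adding a strand on the right of a leg. -/
theorem leg_succ_right {k l m : ℕ} (h : k + 2 + l = m) (h' : k + 2 + (l + 1) = m + 1) :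
    leg T k (l + 1) (m + 1) h' = snocEnd m (leg T k l m h) := by
  refine LinearMap.ext fun x => ?_
  obtain ⟨q, rfl⟩ := (snocEquiv m).surjective x
  induction q with
  | zero => simp only [map_zero]
  | add q r hq hr => simp only [map_add, hq, hr]
  | tmul Z u =>
    rw [snocEnd_apply_snocEquiv]
    induction Z using placeEquiv_induction h with
    | hz => simp
    | ha x y hx hy => simp only [TensorProduct.add_tmul, map_add, hx, hy]
    | ht X S Y =>
      rw [leg_placeEquiv, snocEquiv_placeEquiv h h', snocEquiv_placeEquiv h h', leg_placeEquiv]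

/-- An operator of the form `1 ⊗ 1 ⊗ f` acts on the last factor of `(H ⊗ H) ⊗ H^{⊗l}`. -/
theorem consEnd_consEnd_placeEquiv {l : ℕ} (h : 0 + 2 + l = l + 1 + 1)
    (f : Module.End ℂ (⨂[ℂ]^l H)) (S : H ⊗[ℂ] H) (Z : ⨂[ℂ]^l H) :
    consEnd (l + 1) (consEnd l f)
        (placeEquiv 0 l _ h ((PiTensorProduct.tprod ℂ Fin.elim0 ⊗ₜ S) ⊗ₜ Z)) =
      placeEquiv 0 l _ h ((PiTensorProduct.tprod ℂ Fin.elim0 ⊗ₜ S) ⊗ₜ f Z) := by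
  induction S with
  | zero => simp
  | add S S' hS hS' => simp only [TensorProduct.tmul_add, TensorProduct.add_tmul, map_add, hS, hS']
  | tmul u v =>
    rw [← consEquiv_consEquiv h rfl, ← consEquiv_consEquiv h rfl, TensorPower.cast_refl,
      LinearEquiv.refl_apply, consEnd_apply_consEquiv, consEnd_apply_consEquiv,
      LinearEquiv.refl_apply]

theorem commute_leg_zero {l : ℕ} (h : 0 + 2 + l = l + 1 + 1) (f : Module.End ℂ (⨂[ℂ]^l H)) :
    Commute (leg T 0 l (l + 1 + 1) h) (consEnd (l + 1) (consEnd l f)) := by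
  refine LinearMap.ext fun x => ?_
  simp only [Module.End.mul_apply]
  induction x using placeEquiv_induction h with
  | hz => simp
  | ha x y hx hy => simp only [map_add, hx, hy]
  | ht X S Z =>
    -- `H^{⊗0}` is spanned by the empty tensor
    induction X using PiTensorProduct.induction_on with
    | add X Y hX hY => simp only [TensorProduct.add_tmul, map_add, hX, hY]
    | smul_tprod r x =>
      obtain rfl : x = Fin.elim0 := Subsingleton.elim _ _
      simp only [← TensorProduct.smul_tmul', map_smul]
      rw [consEnd_consEnd_placeEquiv, leg_placeEquiv, leg_placeEquiv, consEnd_consEnd_placeEquiv]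

theorem commute_leg {k l j p m : ℕ} (h : k + 2 + l = m) (h' : j + 2 + p = m) (hkj : k + 2 ≤ j) :
    Commute (leg T k l m h) (leg T j p m h') := by
  induction k generalizing j m with
  | zero =>
    obtain ⟨j, rfl⟩ : ∃ i, j = i + 1 + 1 := ⟨j - 2, by omega⟩
    obtain rfl : m = l + 1 + 1 := by omega
    rw [leg_succ_left T (show j + 1 + 2 + p = l + 1 by omega),
      leg_succ_left T (show j + 2 + p = l by omega)]
    exact commute_leg_zero T h _
  | succ k ih =>
    obtain ⟨j, rfl⟩ : ∃ i, j = i + 1 := ⟨j - 1, by omega⟩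
    obtain ⟨m, rfl⟩ : ∃ i, m = i + 1 := ⟨m - 1, by omega⟩
    rw [leg_succ_left T (show k + 2 + l = m by omega),
      leg_succ_left T (show j + 2 + p = m by omega)]
    exact (ih _ _ (by omega)).map (consEnd m)

variable {T}

theorem IsBraided.leg_braid (hT : IsBraided T) {k l m : ℕ} (h : k + 2 + (l + 1) = m)
    (h' : k + 1 + 2 + l = m) :
    leg T k (l + 1) m h * leg T (k + 1) l m h' * leg T k (l + 1) m h =
      leg T (k + 1) l m h' * leg T k (l + 1) m h * leg T (k + 1) l m h' := by
  induction k generalizing m with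
  | zero =>
    induction l generalizing m with
    | zero =>
      obtain rfl : m = 3 := by omega
      exact hT
    | succ l ih =>
      obtain ⟨m, rfl⟩ : ∃ i, m = i + 1 := ⟨m - 1, by omega⟩
      rw [leg_succ_right T (show 0 + 2 + (l + 1) = m by omega),
        leg_succ_right T (show 0 + 1 + 2 + l = m by omega)]
      simp only [← map_mul]
      rw [ih]
  | succ k ih =>
    obtain ⟨m, rfl⟩ : ∃ i, m = i + 1 := ⟨m - 1, by omega⟩
    rw [leg_succ_left T (show k + 2 + (l + 1) = m by omega),
      leg_succ_left T (show k + 1 + 2 + l = m by omega)]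
    simp only [← map_mul]
    rw [ih]

theorem IsBraided.isBraidFamily_legs (hT : IsBraided T) (n : ℕ) : IsBraidFamily (legs T n) where
  braid i j hij := by
    obtain ⟨i, hi⟩ := i
    obtain ⟨j, hj⟩ := j
    obtain rfl : i + 1 = j := hij
    obtain ⟨l, rfl⟩ : ∃ l, n = i + 1 + (l + 1) := ⟨n - i - 2, by omega⟩
    have h1 : i + 1 + (l + 1) - 1 - i = l + 1 := by omega
    have h2 : i + 1 + (l + 1) - 1 - (i + 1) = l := by omega
    simp only [legs, h1, h2]
    exact hT.leg_braid _ _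
  comm i j hij := commute_leg T _ _ hij

theorem map_rElt {A B : Type*} [Ring A] [Ring B] (f : A →+* B) {n : ℕ} (t : Fin n → A) :
    f (rElt t) = rElt fun i => f (t i) := by
  induction n with
  | zero => simp [rElt]
  | succ n ih => rw [rElt_succ, rElt_succ, map_add, map_one, map_mul, ih]; rfl

theorem map_pElt {A B : Type*} [Ring A] [Ring B] (f : A →+* B) {n : ℕ} (t : Fin n → A) :
    f (pElt n t) = pElt n fun i => f (t i) := by
  induction n with
  | zero => simp [pElt]
  | succ n ih => rw [pElt, pElt, map_mul, ih, map_rElt]; rfl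

/-- The Fock operators are the elements `P_{n+1}` of the legs, because `1 ⊗ ·` shifts the legs by
one strand. -/
theorem fockP_succ (T : Module.End ℂ (H ⊗[ℂ] H)) (n : ℕ) :
    fockP T (n + 1) = pElt n (legs T n) := by
  induction n with
  | zero =>
    change consEnd 0 1 * rElt (legs T 0) = 1
    simp [rElt]
  | succ n ih =>
    change consEnd (n + 1) (fockP T (n + 1)) * rElt (legs T (n + 1)) = _
    rw [ih, pElt]
    congr 1
    refine (map_pElt (consEnd (H := H) (n + 1)).toRingHom (legs T n)).trans (congrArg _ ?_)
    funext i
    have h : n + 1 - 1 - (i + 1 : ℕ) = n - 1 - i := by omega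
    simp only [Fin.tail, legs, Fin.val_succ, h]
    exact (leg_succ_left T _ _).symm

/-- Tensoring with `H^{⊗k}` and `H^{⊗l}` is exact, so it preserves the kernel of `1 + T`. -/
theorem placeSubmodule_ker_one_add (T : Module.End ℂ (H ⊗[ℂ] H)) {k l m : ℕ}
    (h : k + 2 + l = m) :
    placeSubmodule (LinearMap.ker (1 + T)) k l m h = LinearMap.ker (1 + leg T k l m h) := by
  have hex := Module.Flat.rTensor_exact (⨂[ℂ]^l H)
    (Module.Flat.lTensor_exact (⨂[ℂ]^k H) (1 + T).exact_subtype_ker_map)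
  have h1 : 1 + leg T k l m h = (placeEquiv k l m h).conj
      (LinearMap.rTensor (⨂[ℂ]^l H) (LinearMap.lTensor (⨂[ℂ]^k H) (1 + T))) := by
    rw [LinearMap.lTensor_add, LinearMap.rTensor_add, map_add]
    congr 1
    change _ = (placeEquiv k l m h).conj (LinearMap.rTensor _ (LinearMap.lTensor _ LinearMap.id))
    rw [LinearMap.lTensor_id, LinearMap.rTensor_id, LinearEquiv.conj_id]
    rfl
  rw [placeSubmodule, h1]
  change (LinearMap.range (LinearMap.rTensor _ (LinearMap.lTensor _ _))).map _ = _
  rw [← hex.linearMap_ker_eq]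
  ext x
  rw [Submodule.mem_map_equiv, LinearMap.mem_ker, LinearMap.mem_ker,
    LinearEquiv.conj_apply_apply, LinearEquiv.map_eq_zero_iff]

end TensorPowers

/-! ### The Hilbert space structure of tensor powers -/

noncomputable section Coordinates

-- The nested tensor product `(C ⊗ (H ⊗ H)) ⊗ D` of inner product spaces needs a deeper instance
-- search than the default.
set_option maxSynthPendingDepth 6

variable {H : Type*} [NormedAddCommGroup H] [InnerProductSpace ℂ H] [FiniteDimensional ℂ H]

variable (H) in
/-- The coordinate space of `H^{⊗m}` with respect to an orthonormal basis of `H`. It carries the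
Hilbert space structure of the tensor power. -/
def CoordSpace (m : ℕ) : Type :=
  EuclideanSpace ℂ (Fin m → Fin (Module.finrank ℂ H))

instance (m : ℕ) : NormedAddCommGroup (CoordSpace H m) :=
  inferInstanceAs (NormedAddCommGroup (EuclideanSpace ℂ (Fin m → Fin (Module.finrank ℂ H))))

instance (m : ℕ) : InnerProductSpace ℂ (CoordSpace H m) :=
  inferInstanceAs (InnerProductSpace ℂ (EuclideanSpace ℂ (Fin m → Fin (Module.finrank ℂ H))))

instance (m : ℕ) : FiniteDimensional ℂ (CoordSpace H m) :=
  inferInstanceAs (FiniteDimensional ℂ (EuclideanSpace ℂ (Fin m → Fin (Module.finrank ℂ H))))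

instance (m : ℕ) : CompleteSpace (CoordSpace H m) :=
  FiniteDimensional.complete ℂ _

variable (H) in
/-- The standard orthonormal basis of the coordinate space. -/
def coordBasis (m : ℕ) :
    OrthonormalBasis (Fin m → Fin (Module.finrank ℂ H)) ℂ (CoordSpace H m) :=
  EuclideanSpace.basisFun _ ℂ

variable (H) in
/-- The coordinates of a tensor with respect to the tensor power of an orthonormal basis. -/
def coordEquiv (m : ℕ) : (⨂[ℂ]^m H) ≃ₗ[ℂ] CoordSpace H m :=
  (Basis.piTensorProduct fun _ => (stdOrthonormalBasis ℂ H).toBasis).equiv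
    (coordBasis H m).toBasis (Equiv.refl _)

theorem coordEquiv_tprod {m : ℕ} (p : Fin m → Fin (Module.finrank ℂ H)) :
    coordEquiv H m (PiTensorProduct.tprod ℂ fun i => stdOrthonormalBasis ℂ H (p i)) =
      coordBasis H m p := by
  have := (Basis.piTensorProduct fun _ : Fin m => (stdOrthonormalBasis ℂ H).toBasis).equiv_apply p
    (coordBasis H m).toBasis (Equiv.refl _)
  simpa [Basis.piTensorProduct_apply, coordEquiv] using this

omit [FiniteDimensional ℂ H] in
theorem placeEquiv_tprod {k l m : ℕ} (h : k + 2 + l = m) (x : Fin k → H) (u v : H)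
    (y : Fin l → H) :
    placeEquiv k l m h
        ((PiTensorProduct.tprod ℂ x ⊗ₜ (u ⊗ₜ v)) ⊗ₜ PiTensorProduct.tprod ℂ y) =
      PiTensorProduct.tprod ℂ (Fin.append (Fin.append x ![u, v]) y ∘ Fin.cast h.symm) := by
  subst h
  apply toTensorAlgebra_injective
  rw [toTensorAlgebra_placeEquiv, toTensorAlgebra_twoEquiv, oneEquiv_apply, oneEquiv_apply]
  simp only [TensorPower.toTensorAlgebra_tprod, TensorAlgebra.tprod_apply, Fin.cast_refl,
    Function.comp_id]
  rw [List.ofFn_comp' x, List.ofFn_comp' y, List.ofFn_comp' (Fin.append _ _),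
    List.ofFn_fin_append, List.ofFn_fin_append]
  simp [mul_assoc]

/-- The identification `H^{⊗k} ⊗ (H ⊗ H) ⊗ H^{⊗l} ≃ H^{⊗m}` in coordinates. -/
def coordPlace {k l m : ℕ} (h : k + 2 + l = m) :
    (CoordSpace H k ⊗[ℂ] (H ⊗[ℂ] H)) ⊗[ℂ] CoordSpace H l ≃ₗ[ℂ] CoordSpace H m :=
  ((TensorProduct.congr (TensorProduct.congr (coordEquiv H k).symm (LinearEquiv.refl ℂ _))
    (coordEquiv H l).symm).trans (placeEquiv k l m h)).trans (coordEquiv H m)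

/-- The concatenated word determines its three parts. -/
theorem append_append_injective {α : Type*} {k l m : ℕ} (h : k + 2 + l = m) :
    Function.Injective fun p : ((Fin k → α) × (α × α)) × (Fin l → α) =>
      Fin.append (Fin.append p.1.1 ![p.1.2.1, p.1.2.2]) p.2 ∘ Fin.cast h.symm := by
  subst h
  rintro ⟨⟨p, a, b⟩, q⟩ ⟨⟨p', a', b'⟩, q'⟩ hpq
  replace hpq : Fin.append (Fin.append p ![a, b]) q = Fin.append (Fin.append p' ![a', b']) q' := hpq
  have hq : q = q' := funext fun i => by simpa using congrFun hpq (Fin.natAdd _ i)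
  have hp : p = p' := funext fun i => by
    simpa using congrFun hpq (Fin.castAdd l (Fin.castAdd 2 i))
  have ha : a = a' := by simpa using congrFun hpq (Fin.castAdd l (Fin.natAdd k 0))
  have hb : b = b' := by simpa using congrFun hpq (Fin.castAdd l (Fin.natAdd k 1))
  rw [hq, hp, ha, hb]

/-- The identification is isometric, as it maps an orthonormal basis of product vectors injectively
into the orthonormal basis of `H^{⊗m}`. -/
theorem norm_coordPlace {k l m : ℕ} (h : k + 2 + l = m)
    (x : (CoordSpace H k ⊗[ℂ] (H ⊗[ℂ] H)) ⊗[ℂ] CoordSpace H l) :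
    ‖coordPlace h x‖ = ‖x‖ := by
  let b := stdOrthonormalBasis ℂ H
  let B := ((coordBasis H k).tensorProduct (b.tensorProduct b)).tensorProduct (coordBasis H l)
  have hB : Orthonormal ℂ B.toBasis := by simp
  have hF : Orthonormal ℂ ((coordPlace h : _ ≃ₗ[ℂ] CoordSpace H m).toLinearMap ∘ B.toBasis) := by
    suffices heq : (coordPlace h : _ ≃ₗ[ℂ] CoordSpace H m).toLinearMap ∘ B.toBasis =
        coordBasis H m ∘ fun p =>
          Fin.append (Fin.append p.1.1 ![p.1.2.1, p.1.2.2]) p.2 ∘ Fin.cast h.symm by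
      rw [heq]
      exact (coordBasis H m).orthonormal.comp _ (append_append_injective h)
    funext ⟨⟨p, i, j⟩, q⟩
    have hp (n : ℕ) (p : Fin n → Fin (Module.finrank ℂ H)) :
        (coordEquiv H n).symm (coordBasis H n p) =
          PiTensorProduct.tprod ℂ fun i => b (p i) := by
      rw [LinearEquiv.symm_apply_eq, coordEquiv_tprod]
    simp only [Function.comp_apply, OrthonormalBasis.coe_toBasis, B,
      OrthonormalBasis.tensorProduct_apply, coordPlace, LinearEquiv.coe_coe,
      LinearEquiv.trans_apply, TensorProduct.congr_tmul, LinearEquiv.refl_apply, hp,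
      placeEquiv_tprod]
    rw [← coordEquiv_tprod]
    congr 2
    funext n
    -- appending tuples commutes with applying a function to their entries
    have hap (f : Fin (Module.finrank ℂ H) → H) {c d : ℕ} (x : Fin c → _) (y : Fin d → _) :
        (fun i => f (Fin.append x y i)) = Fin.append (fun i => f (x i)) fun i => f (y i) := by
      funext i
      refine Fin.addCases (fun i => ?_) (fun i => ?_) i <;> simp
    have h2 : (fun n => b (![i, j] n)) = ![b i, b j] := by
      funext n; fin_cases n <;> rfl
    simp only [Function.comp_apply]
    rw [← h2, ← hap, ← hap]
  exact ((coordPlace h).toLinearMap.isometryOfOrthonormal hB hF).norm_map x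

/-- The isometry form of `coordPlace`. -/
def coordPlaceIsometry {k l m : ℕ} (h : k + 2 + l = m) :
    (CoordSpace H k ⊗[ℂ] (H ⊗[ℂ] H)) ⊗[ℂ] CoordSpace H l ≃ₗᵢ[ℂ] CoordSpace H m :=
  ⟨coordPlace h, norm_coordPlace h⟩

theorem coordPlaceIsometry_apply {k l m : ℕ} (h : k + 2 + l = m)
    (x : (CoordSpace H k ⊗[ℂ] (H ⊗[ℂ] H)) ⊗[ℂ] CoordSpace H l) :
    coordPlaceIsometry h x = coordPlace h x :=
  rfl

/-- Operators on a tensor power, as operators on its coordinate space. -/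
def coordEnd (m : ℕ) : Module.End ℂ (⨂[ℂ]^m H) ≃ₐ[ℂ] (CoordSpace H m →L[ℂ] CoordSpace H m) :=
  ((coordEquiv H m).conjAlgEquiv ℂ).trans (Module.End.toContinuousLinearMap _)

theorem coordEnd_apply {m : ℕ} (f : Module.End ℂ (⨂[ℂ]^m H)) (x : CoordSpace H m) :
    coordEnd m f x = coordEquiv H m (f ((coordEquiv H m).symm x)) :=
  rfl

/-- In coordinates, `1 ⊗ T ⊗ 1` is unitarily equivalent to the tensor product of `T` with
identities. -/
theorem coordEnd_leg (T : H ⊗[ℂ] H →L[ℂ] H ⊗[ℂ] H) {k l m : ℕ} (h : k + 2 + l = m)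
    (x : (CoordSpace H k ⊗[ℂ] (H ⊗[ℂ] H)) ⊗[ℂ] CoordSpace H l) :
    coordEnd m (leg (T : Module.End ℂ (H ⊗[ℂ] H)) k l m h) (coordPlaceIsometry h x) =
      coordPlaceIsometry h
        (ContinuousLinearMap.rTensor _ (ContinuousLinearMap.lTensor _ T) x) := by
  simp only [coordPlaceIsometry_apply]
  induction x with
  | zero => simp only [map_zero]
  | add x y hx hy => simp only [map_add, hx, hy]
  | tmul x Y =>
    induction x with
    | zero => simp only [TensorProduct.zero_tmul, map_zero]
    | add x y hx hy => simp only [TensorProduct.add_tmul, map_add, hx, hy]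
    | tmul X S =>
      simp [coordEnd_apply, coordPlace, leg_placeEquiv]

theorem norm_coordEnd_leg_le {T : H ⊗[ℂ] H →L[ℂ] H ⊗[ℂ] H} (hT : ‖T‖ ≤ 1) {k l m : ℕ}
    (h : k + 2 + l = m) : ‖coordEnd m (leg (T : Module.End ℂ (H ⊗[ℂ] H)) k l m h)‖ ≤ 1 := by
  refine ContinuousLinearMap.opNorm_le_bound _ zero_le_one fun y => ?_
  obtain ⟨x, rfl⟩ := (coordPlaceIsometry h).surjective y
  rw [coordEnd_leg, LinearIsometryEquiv.norm_map, LinearIsometryEquiv.norm_map]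
  refine ContinuousLinearMap.le_of_opNorm_le _ ?_ x
  exact (ContinuousLinearMap.norm_rTensor_le _ _).trans
    ((ContinuousLinearMap.norm_lTensor_le _ _).trans hT)

theorem isSelfAdjoint_coordEnd_leg {T : H ⊗[ℂ] H →L[ℂ] H ⊗[ℂ] H}
    (hT : (T : Module.End ℂ (H ⊗[ℂ] H)).IsSymmetric) {k l m : ℕ} (h : k + 2 + l = m) :
    IsSelfAdjoint (coordEnd m (leg (T : Module.End ℂ (H ⊗[ℂ] H)) k l m h)) := by
  have : CompleteSpace H := FiniteDimensional.complete ℂ H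
  have : CompleteSpace (H ⊗[ℂ] H) := FiniteDimensional.complete ℂ _
  have : CompleteSpace (CoordSpace H k ⊗[ℂ] (H ⊗[ℂ] H)) := FiniteDimensional.complete ℂ _
  have : CompleteSpace ((CoordSpace H k ⊗[ℂ] (H ⊗[ℂ] H)) ⊗[ℂ] CoordSpace H l) :=
    FiniteDimensional.complete ℂ _
  have hT' : T.adjoint = T := ContinuousLinearMap.isSelfAdjoint_iff_isSymmetric.2 hT
  have hS : IsSelfAdjoint (ContinuousLinearMap.rTensor (CoordSpace H l)
      (ContinuousLinearMap.lTensor (CoordSpace H k) T)) := by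
    rw [IsSelfAdjoint, ContinuousLinearMap.star_eq_adjoint, ContinuousLinearMap.adjoint_rTensor,
      ContinuousLinearMap.adjoint_lTensor, hT']
  rw [ContinuousLinearMap.isSelfAdjoint_iff_isSymmetric]
  intro y y'
  obtain ⟨x, rfl⟩ := (coordPlaceIsometry h).surjective y
  obtain ⟨x', rfl⟩ := (coordPlaceIsometry h).surjective y'
  rw [ContinuousLinearMap.coe_coe, coordEnd_leg, coordEnd_leg, LinearIsometryEquiv.inner_map_map,
    LinearIsometryEquiv.inner_map_map]
  exact hS.isSymmetric x x'

theorem ker_coordEnd {m : ℕ} (f : Module.End ℂ (⨂[ℂ]^m H)) :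
    LinearMap.ker (coordEnd m f).toLinearMap =
      (LinearMap.ker f).map (coordEquiv H m).toLinearMap := by
  ext x
  rw [Submodule.mem_map_equiv, LinearMap.mem_ker, LinearMap.mem_ker]
  exact LinearEquiv.map_eq_zero_iff (coordEquiv H m)

theorem ker_fockP {T : H ⊗[ℂ] H →L[ℂ] H ⊗[ℂ] H}
    (hsa : (T : Module.End ℂ (H ⊗[ℂ] H)).IsSymmetric) (hn : ‖T‖ ≤ 1)
    (hT : IsBraided (T : Module.End ℂ (H ⊗[ℂ] H))) (n : ℕ) :
    LinearMap.ker (fockP (T : Module.End ℂ (H ⊗[ℂ] H)) (n + 1)) =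
      ⨆ k : Fin n, LinearMap.ker (1 + legs (T : Module.End ℂ (H ⊗[ℂ] H)) n k) := by
  let Φ := coordEnd (H := H) (n + 1)
  have hb := hT.isBraidFamily_legs n
  have key := ker_pElt_of_finiteDimensional
    (t := fun k => Φ (legs (T : Module.End ℂ (H ⊗[ℂ] H)) n k))
    (fun k => isSelfAdjoint_coordEnd_leg hsa _) (fun k => norm_coordEnd_leg_le hn _)
    ⟨fun i j hij => by simp only [← map_mul, hb.braid i j hij],
      fun i j hij => by simp only [← map_mul, hb.comm i j hij]⟩
  have hp : (pElt n fun k => Φ (legs (T : Module.End ℂ (H ⊗[ℂ] H)) n k)) =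
      Φ (fockP (T : Module.End ℂ (H ⊗[ℂ] H)) (n + 1)) := by
    rw [fockP_succ]
    exact (map_pElt Φ.toAlgHom.toRingHom _).symm
  have h1 (k : Fin n) : 1 + Φ (legs (T : Module.End ℂ (H ⊗[ℂ] H)) n k) =
      Φ (1 + legs (T : Module.End ℂ (H ⊗[ℂ] H)) n k) := by rw [map_add, map_one]
  simp only [hp, h1, Φ, ker_coordEnd, ← Submodule.map_iSup] at key
  exact Submodule.map_injective_of_injective (coordEquiv H (n + 1)).injective key

omit [FiniteDimensional ℂ H] in
theorem iSup_placeSubmodule (T : Module.End ℂ (H ⊗[ℂ] H)) (n : ℕ) :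
    ⨆ (k : ℕ) (l : ℕ) (h : k + 2 + l = n + 1),
      placeSubmodule (LinearMap.ker (1 + T)) k l (n + 1) h =
        ⨆ k : Fin n, LinearMap.ker (1 + legs T n k) := by
  simp only [placeSubmodule_ker_one_add]
  refine le_antisymm (iSup_le fun k => iSup_le fun l => iSup_le fun h => ?_)
    (iSup_le fun k => ?_)
  · obtain rfl : l = n - 1 - k := by omega
    exact le_iSup_of_le (⟨k, by omega⟩ : Fin n) le_rfl
  · exact le_iSup_of_le (k : ℕ) (le_iSup_of_le (n - 1 - k)
      (le_iSup_of_le (by omega) le_rfl))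

end Coordinates

end Wick

theorem theorem2 :
    (∀ (H : Type*) [NormedAddCommGroup H] [InnerProductSpace ℂ H] [FiniteDimensional ℂ H]
        (T : H ⊗[ℂ] H →L[ℂ] H ⊗[ℂ] H),
        (T : Module.End ℂ (H ⊗[ℂ] H)).IsSymmetric → ‖T‖ ≤ 1 →
        Wick.IsBraided (T : Module.End ℂ (H ⊗[ℂ] H)) →
        ∀ n : ℕ, 2 ≤ n →
          LinearMap.ker (Wick.fockP (T : Module.End ℂ (H ⊗[ℂ] H)) (n + 1)) =
              ⨆ (k : ℕ) (l : ℕ) (h : k + 2 + l = n + 1),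
                Wick.placeSubmodule (LinearMap.ker (1 + (T : Module.End ℂ (H ⊗[ℂ] H))))
                  k l (n + 1) h ∧
          LinearMap.ker (Wick.fockP (T : Module.End ℂ (H ⊗[ℂ] H)) (n + 1)) =
              ⨆ k : Fin n,
                LinearMap.ker (1 + Wick.legs (T : Module.End ℂ (H ⊗[ℂ] H)) n k)) ∧
    (∀ (K : Type*) [NormedAddCommGroup K] [InnerProductSpace ℂ K] [CompleteSpace K]
        (n : ℕ) (t : Fin n → K →L[ℂ] K),
        (∀ k, IsSelfAdjoint (t k)) → (∀ k, ‖t k‖ ≤ 1) → Wick.IsBraidFamily t →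
        LinearMap.ker (Wick.pElt n t : K →L[ℂ] K).toLinearMap =
            (⨆ k : Fin n, LinearMap.ker (1 + t k : K →L[ℂ] K).toLinearMap).topologicalClosure ∧
        (FiniteDimensional ℂ K →
          LinearMap.ker (Wick.pElt n t : K →L[ℂ] K).toLinearMap =
            ⨆ k : Fin n, LinearMap.ker (1 + t k : K →L[ℂ] K).toLinearMap)) := by
  refine ⟨?_, ?_⟩
  · intro H _ _ _ T hsa hn hT n _
    exact ⟨(Wick.ker_fockP hsa hn hT n).trans (Wick.iSup_placeSubmodule _ n).symm,
      Wick.ker_fockP hsa hn hT n⟩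
  · intro K _ _ _ n t hsa hn ht
    exact ⟨Wick.ker_pElt hsa hn ht, fun _ => Wick.ker_pElt_of_finiteDimensional hsa hn ht⟩
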